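/- Let $p\in[0,1]$. For $L\ge 1$ consider random periodic combs of length $L$: the spine is the cycle $\mathbb Z/L\mathbb Z$, and to each spine vertex $n$, independently, a tooth (an infinite half-line with vertices $(n,1),(n,2),\dots$, where $(n,1)$ is joined to the spine vertex $(n,0)$ and $(n,j)$ to $(n,j+1)$) is attached with probability $1-p$, while no tooth is attached with probability $p$. For a comb $\mathcal C$ let $H$ be minus the graph Laplacian on $\ell^2(\mathcal C)$, $H\phi(v)=\sum_{w\sim v}(\phi(v)-\phi(w))$. The probability that a quantum walker (with evolution $e^{-\mathrm i TH}$) started in the state $\Phi_{n_0}$ concentrated at the spine vertex $(n_0,0)$ stays localized near the spine is the squared norm of the $E>4$ part of its state (which does not depend on the time $T$), $$P^{\mathrm{loc}}(n_0)=\sum_\sigma\bigl|\langle\Gamma_\sigma|\Phi_{n_0}\rangle\bigr|^2 ,$$ where $(\Gamma_\sigma)$ is an orthonormal basis, consisting of eigenfunctions, of the space spanned by the $\ell^2$-eigenfunctions of $H$ with energy $E>4$. Let $\mathbb E_L$ denote the average over the random combs of length $L$. Then there is an $L_0$ (which may depend on $p$) such that for all $L\ge L_0$ and all $n_0\in\mathbb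 Z/L\mathbb Z$, $$\mathbb E_L\bigl[P^{\mathrm{loc}}(n_0)\bigr]\ \le\ \frac{1-p}{2-p}.$$ -/

import Mathlib

namespace RandomComb

/-- Vertices of the periodic comb of length `L` whose teeth are attached at the spine sites `n` with
`χ n = true` (the sites with `χ n = false` are the holes): the spine vertices `(n, 0)`, and the
vertices `(n, j)`, `j ≥ 1`, of the infinite tooth at `n` when `χ n = true`. -/
abbrev Vertex {L : ℕ} (χ : ZMod L → Bool) : Type :=
  {v : ZMod L × ℕ // v.2 = 0 ∨ χ v.1 = true}

/-- The spine vertex `(n, 0)`. -/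
def spine {L : ℕ} (χ : ZMod L → Bool) (n : ZMod L) : Vertex χ :=
  ⟨(n, 0), Or.inl rfl⟩

/-- The periodic comb: the spine is the cycle `ℤ/L`, and along a tooth `(n, j)` is joined to
`(n, j + 1)`. -/
def comb {L : ℕ} (χ : ZMod L → Bool) : SimpleGraph (Vertex χ) where
  Adj v w := v ≠ w ∧
    ((v.1.2 = 0 ∧ w.1.2 = 0 ∧ (w.1.1 = v.1.1 + 1 ∨ v.1.1 = w.1.1 + 1)) ∨
      (v.1.1 = w.1.1 ∧ (w.1.2 = v.1.2 + 1 ∨ v.1.2 = w.1.2 + 1)))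
  symm := ⟨by
    rintro v w ⟨hne, h⟩
    refine ⟨hne.symm, ?_⟩
    rcases h with ⟨h1, h2, h3⟩ | ⟨h1, h2⟩
    · exact Or.inl ⟨h2, h1, h3.symm⟩
    · exact Or.inr ⟨h1.symm, h2.symm⟩⟩
  loopless := ⟨fun v h => h.1 rfl⟩

theorem comb_neighborSet_finite {L : ℕ} (χ : ZMod L → Bool) (v : Vertex χ) :
    ((comb χ).neighborSet v).Finite := by
  have hfin : ({(v.1.1 + 1, 0), (v.1.1 - 1, 0), (v.1.1, v.1.2 + 1), (v.1.1, v.1.2 - 1)} :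
      Set (ZMod L × ℕ)).Finite := by simp
  refine Set.Finite.of_finite_image (f := Subtype.val) (hfin.subset ?_)
    (Subtype.val_injective.injOn)
  rintro _ ⟨⟨⟨m, k⟩, hw⟩, ⟨-, h⟩, rfl⟩
  rcases h with ⟨-, h2, h3 | h3⟩ | ⟨h1, h2 | h2⟩ <;> simp_all

noncomputable instance {L : ℕ} (χ : ZMod L → Bool) : (comb χ).LocallyFinite :=
  fun v => (comb_neighborSet_finite χ v).fintype

/-- The Hamiltonian (minus the graph Laplacian): `(H φ)(v) = ∑_{w ∼ v} (φ v - φ w)`. -/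
noncomputable def hamiltonian {L : ℕ} (χ : ZMod L → Bool) :
    Module.End ℂ (Vertex χ → ℂ) where
  toFun φ v := ∑ w ∈ (comb χ).neighborFinset v, (φ v - φ w)
  map_add' φ ψ := by
    ext v
    simp only [Pi.add_apply, ← Finset.sum_add_distrib]
    exact Finset.sum_congr rfl fun w _ => by ring
  map_smul' c φ := by
    ext v
    simp only [Pi.smul_apply, smul_eq_mul, RingHom.id_apply, Finset.mul_sum]
    exact Finset.sum_congr rfl fun w _ => by ring

/-- The Hilbert space of square summable functions on the vertices of the comb. -/
abbrev Hilb {L : ℕ} (χ : ZMod L → Bool) : Type :=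
  lp (fun _ : Vertex χ => ℂ) 2

/-- The space of square summable eigenfunctions of the Hamiltonian with energy `E`. -/
noncomputable def energyEigenspace {L : ℕ} (χ : ZMod L → Bool) (E : ℝ) :
    Submodule ℂ (Hilb χ) where
  carrier := {φ | hamiltonian χ (φ : Vertex χ → ℂ) = (E : ℂ) • (φ : Vertex χ → ℂ)}
  add_mem' {φ ψ} hφ hψ := by
    simp only [Set.mem_ofPred_eq] at hφ hψ ⊢
    rw [lp.coeFn_add, map_add, hφ, hψ, smul_add]
  zero_mem' := by
    simp only [Set.mem_ofPred_eq]
    rw [lp.coeFn_zero, map_zero, smul_zero]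
  smul_mem' c φ hφ := by
    simp only [Set.mem_ofPred_eq] at hφ ⊢
    rw [lp.coeFn_smul, map_smul, hφ, smul_comm]

/-- The closed subspace spanned by all energy eigenstates with energy `E > 4`. -/
noncomputable def locSubspace {L : ℕ} (χ : ZMod L → Bool) : Submodule ℂ (Hilb χ) :=
  (⨆ E : Set.Ioi (4 : ℝ), energyEigenspace χ E).topologicalClosure

instance {L : ℕ} (χ : ZMod L → Bool) : CompleteSpace (locSubspace χ) :=
  (Submodule.isClosed_topologicalClosure _).completeSpace_coe

open Classical in
/-- The state of a walker located at the spine vertex `(n, 0)`. -/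
noncomputable def initialState {L : ℕ} (χ : ZMod L → Bool) (n : ZMod L) : Hilb χ :=
  lp.single 2 (spine χ n) (1 : ℂ)

/-- The probability to stay localized near the spine, starting from `(n, 0)`: the squared norm of
the `E > 4` part of the initial state. By `hasSum_Ploc` it is the sum of `|⟨Γ, Φ⟩|²` over an
orthonormal basis `Γ` of the `E > 4` states. -/
noncomputable def Ploc {L : ℕ} (χ : ZMod L → Bool) (n : ZMod L) : ℝ :=
  ‖(locSubspace χ).starProjection (initialState χ n)‖ ^ 2

/-- For every Hilbert basis `Γ` of the `E > 4` subspace,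
`P^loc(n) = ∑_σ |⟨Γ_σ, Φ_n⟩|²`. -/
theorem hasSum_Ploc {L : ℕ} (χ : ZMod L → Bool) (n : ZMod L) {ι : Type*}
    (Γ : HilbertBasis ι ℂ (locSubspace χ)) :
    HasSum (fun σ => ‖inner ℂ (Γ σ : Hilb χ) (initialState χ n)‖ ^ 2) (Ploc χ n) := by
  have h := Γ.hasSum_inner_mul_inner
    ((locSubspace χ).orthogonalProjectionOnto (initialState χ n))
    ((locSubspace χ).orthogonalProjectionOnto (initialState χ n))
  have h2 := (Complex.reCLM.hasSum h)
  convert h2 using 1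
  · ext σ
    have h3 : inner ℂ (Γ σ) ((locSubspace χ).orthogonalProjectionOnto (initialState χ n)) =
        inner ℂ (Γ σ : Hilb χ) (initialState χ n) :=
      Submodule.inner_orthogonalProjectionOnto_eq_of_mem_left _ _
    have h4 : inner ℂ ((locSubspace χ).orthogonalProjectionOnto (initialState χ n)) (Γ σ) =
        (starRingEnd ℂ) (inner ℂ (Γ σ : Hilb χ) (initialState χ n)) := by
      rw [← h3]
      exact (inner_conj_symm (𝕜 := ℂ) _ _).symm
    rw [h4, h3, ← Complex.normSq_eq_conj_mul_self,
      Complex.normSq_eq_norm_sq]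
    simp [← Complex.ofReal_pow]
  · rw [inner_self_eq_norm_sq_to_K, Ploc, Submodule.starProjection_apply]
    simp [← Complex.ofReal_pow]

/-- The probability of the tooth configuration `χ` when each spine site is independently a hole
with probability `p` and carries a tooth with probability `1 - p`. -/
def configProb {L : ℕ} [NeZero L] (p : ℝ) (χ : ZMod L → Bool) : ℝ :=
  ∏ n, if χ n = true then 1 - p else p

/-- The average over the comb disorder. -/
def disorderAverage {L : ℕ} [NeZero L] (p : ℝ) (f : (ZMod L → Bool) → ℝ) : ℝ :=
  ∑ χ, configProb p χ * f χ

end RandomComb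

/-!
Averaging over translations, `L · 𝔼[P^loc(n₀)] = 𝔼[∑ n, P^loc(n)]` (`mul_disorderAverage_Ploc`), and
`∑ n, P^loc(n)` is the sum of the spine masses `∑ n, |Γ (n, 0)|²` over an orthonormal basis `Γ` of
bound states with energies above `4`. So the number of these bound states and the mass that each
has on the teeth have to be controlled.

*Counting.* An edge `{v, w}` contributes `|φ v - φ w|² ≤ 2|φ v|² + 2|φ w|²` to the energy form, and
only the tooth roots have more than two neighbours. Suppose that `A` is a set of sites such that
every tooth root is an end of one of the spine edges `{n, n + 1}`, `n ∈ A`. If `φ` takes equal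
values at the ends of each of these edges, then at every vertex at most two edges contribute, and
the energy form of `φ` is at most `4‖φ‖²`. A combination of bound states satisfying these `|A|`
linear conditions must vanish, so there are at most `|A|` bound states
(`eq_zero_of_spineDiff_eq_zero`).

*Choice of `A`.* In each run of consecutive teeth take the first, the third, the fifth, and so on. A
tooth is selected exactly if its left neighbour is not, which by independence gives the density `x`
of `A` as the solution of `x = (1 - p) (1 - x)`, that is `x = (1 - p) / (2 - p)`. On a ring of
length `L` the density exceeds this value by at most `2 (1 - p) ^ L`
(`disorderAverage_card_selected_le`).

*Mass on the teeth.* The energies are at most `6`, so the eigenvalue equation at the first tooth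
vertex bounds `|φ (n, 0)|²` by the mass of `φ` on the tooth at `n`. At a hole a maximum principle
holds, so `|φ|` is largest on the spine at a tooth root. Hence the spine mass of a normalized bound
state is at most `17 L / (1 + 17 L)`, and at most `17 / 18` on the comb without holes
(`spineMass_le`). For `p > 0` this polynomially small gain beats the exponentially small excess of
the density; for `p = 0` it beats the excess `1 / (2 L)` of the density of every second site.
-/

open scoped ComplexConjugate

/-! ### The Laplacian of a graph of bounded degree -/

namespace SimpleGraph

variable {V : Type*} (G : SimpleGraph V) [G.LocallyFinite]

open Classical in
theorem hasSum_neighborFinset {E : Type*} [AddCommMonoid E] [TopologicalSpace E]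
    (F : V → E) (v : V) :
    HasSum (fun w => if G.Adj v w then F w else 0) (∑ w ∈ G.neighborFinset v, F w) := by
  have h : HasSum (fun w => if G.Adj v w then F w else 0)
      (∑ w ∈ G.neighborFinset v, if G.Adj v w then F w else 0) := by
    refine hasSum_sum_of_ne_finset_zero fun w hw => ?_
    rw [if_neg]
    simpa using hw
  convert h using 1
  refine Finset.sum_congr rfl fun w hw => ?_
  rw [if_pos]
  simpa using hw

open Classical in
/-- A function of the first endpoint that is summable over the vertices is summable over the
ordered edges of a graph of bounded degree. -/
theorem summable_adj_fst {D : ℕ} (hD : ∀ v, (G.neighborFinset v).card ≤ D) {g : V → ℝ}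
    (hg0 : ∀ v, 0 ≤ g v) (hg : Summable g) :
    Summable fun x : V × V => if G.Adj x.1 x.2 then g x.1 else 0 := by
  rw [summable_prod_of_nonneg]
  · refine ⟨fun v => (G.hasSum_neighborFinset (fun _ => g v) v).summable, ?_⟩
    refine Summable.of_nonneg_of_le (fun v => tsum_nonneg fun w => ?_) (fun v => ?_)
      (hg.mul_left (D : ℝ))
    · dsimp only
      split_ifs
      exacts [hg0 v, le_rfl]
    · have := (G.hasSum_neighborFinset (fun _ => g v) v).tsum_eq
      dsimp only
      rw [this, Finset.sum_const, nsmul_eq_mul]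
      exact mul_le_mul_of_nonneg_right (by exact_mod_cast hD v) (hg0 v)
  · intro x
    dsimp only
    split_ifs
    exacts [hg0 _, le_rfl]

open Classical in
theorem summable_adj_snd {D : ℕ} (hD : ∀ v, (G.neighborFinset v).card ≤ D) {g : V → ℝ}
    (hg0 : ∀ v, 0 ≤ g v) (hg : Summable g) :
    Summable fun x : V × V => if G.Adj x.1 x.2 then g x.2 else 0 := by
  have h := (G.summable_adj_fst hD hg0 hg).prod_symm
  refine h.congr fun x => ?_
  simp [G.adj_comm]

open Classical in
/-- Summation over the ordered edges does not depend on which endpoint is summed first. -/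
theorem hasSum_sum_neighborFinset {E : Type*} [NormedAddCommGroup E] [CompleteSpace E]
    {F : V → V → E} (hF : Summable fun x : V × V => if G.Adj x.1 x.2 then F x.1 x.2 else 0) :
    HasSum (fun v => ∑ w ∈ G.neighborFinset v, F v w)
        (∑' x : V × V, if G.Adj x.1 x.2 then F x.1 x.2 else 0) ∧
      HasSum (fun v => ∑ w ∈ G.neighborFinset v, F w v)
        (∑' x : V × V, if G.Adj x.1 x.2 then F x.1 x.2 else 0) := by
  constructor
  · exact hF.hasSum.prod_fiberwise fun v => G.hasSum_neighborFinset (F v) v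
  · have h := (Equiv.prodComm V V).hasSum_iff.mpr hF.hasSum
    refine h.prod_fiberwise fun v => ?_
    convert G.hasSum_neighborFinset (fun w => F w v) v using 2 with w
    simp [G.adj_comm]

open Classical in
theorem summable_adj_of_norm_le {E : Type*} [NormedAddCommGroup E] [CompleteSpace E]
    {D : ℕ} (hD : ∀ v, (G.neighborFinset v).card ≤ D)
    {F : V → V → E} {g h : V → ℝ} (hg0 : ∀ v, 0 ≤ g v) (hg : Summable g)
    (hh0 : ∀ v, 0 ≤ h v) (hh : Summable h) (hF : ∀ v w, ‖F v w‖ ≤ g v + h w) :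
    Summable fun x : V × V => if G.Adj x.1 x.2 then F x.1 x.2 else 0 := by
  refine Summable.of_norm_bounded
    ((G.summable_adj_fst hD hg0 hg).add (G.summable_adj_snd hD hh0 hh)) fun x => ?_
  split_ifs
  · exact hF _ _
  · simp

/-- The graph Laplacian of a graph of bounded degree is symmetric on square summable functions. -/
theorem tsum_conj_laplacian_symm {D : ℕ} (hD : ∀ v, (G.neighborFinset v).card ≤ D)
    {φ ψ : V → ℂ} (hφ : Summable fun v => ‖φ v‖ ^ 2) (hψ : Summable fun v => ‖ψ v‖ ^ 2) :
    ∑' v, conj (∑ w ∈ G.neighborFinset v, (φ v - φ w)) * ψ v =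
      ∑' v, conj (φ v) * ∑ w ∈ G.neighborFinset v, (ψ v - ψ w) := by
  classical
  have key : ∀ a b : ℂ, ‖conj a * b‖ ≤ ‖a‖ ^ 2 + ‖b‖ ^ 2 := fun a b => by
    rw [norm_mul, RCLike.norm_conj]
    nlinarith [sq_nonneg (‖a‖ - ‖b‖), sq_nonneg ‖a‖, sq_nonneg ‖b‖]
  have sd := G.summable_adj_of_norm_le (F := fun v _ => conj (φ v) * ψ v)
    (g := fun v => ‖φ v‖ ^ 2 + ‖ψ v‖ ^ 2) (h := fun _ => 0) hD
    (fun v => by positivity) (hφ.add hψ) (fun _ => le_rfl) summable_zero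
    (fun v w => by simpa using key (φ v) (ψ v))
  have so := G.summable_adj_of_norm_le (F := fun v w => conj (φ v) * ψ w)
    (g := fun v => ‖φ v‖ ^ 2) (h := fun w => ‖ψ w‖ ^ 2) hD
    (fun v => by positivity) hφ (fun v => by positivity) hψ (fun v w => key (φ v) (ψ w))
  have hd := (G.hasSum_sum_neighborFinset (F := fun v _ => conj (φ v) * ψ v) sd).1
  have ho := G.hasSum_sum_neighborFinset (F := fun v w => conj (φ v) * ψ w) so
  have h1 := (hd.sub ho.2).tsum_eq
  have h2 := (hd.sub ho.1).tsum_eq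
  refine (tsum_congr fun v => ?_).trans ((h1.trans h2.symm).trans (tsum_congr fun v => ?_))
  · change _ = ∑ w ∈ G.neighborFinset v, conj (φ v) * ψ v -
      ∑ w ∈ G.neighborFinset v, conj (φ w) * ψ v
    rw [map_sum, Finset.sum_mul, ← Finset.sum_sub_distrib]
    exact Finset.sum_congr rfl fun w _ => by rw [map_sub]; ring
  · change ∑ w ∈ G.neighborFinset v, conj (φ v) * ψ v -
      ∑ w ∈ G.neighborFinset v, conj (φ v) * ψ w = _
    rw [Finset.mul_sum, ← Finset.sum_sub_distrib]
    exact Finset.sum_congr rfl fun w _ => by ring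

open Classical in
/-- In the energy of `φ` an edge contributes `‖φ v - φ w‖² ≤ 2‖φ v‖² + 2‖φ w‖²`, and nothing if `φ`
agrees at its ends; so each vertex is charged only with its edges along which `φ` changes. -/
theorem re_tsum_conj_laplacian_le {D : ℕ} (hD : ∀ v, (G.neighborFinset v).card ≤ D)
    {φ : V → ℂ} (hφ : Summable fun v => ‖φ v‖ ^ 2) {c : ℝ}
    (hc : ∀ v, φ v ≠ 0 → 2 * (({w ∈ G.neighborFinset v | φ w ≠ φ v}.card : ℕ) : ℝ) ≤ c) :
    (∑' v, conj (φ v) * ∑ w ∈ G.neighborFinset v, (φ v - φ w)).re ≤ c * ∑' v, ‖φ v‖ ^ 2 := by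
  have key : ∀ a b : ℂ, ‖conj a * (a - b)‖ ≤ 3 / 2 * ‖a‖ ^ 2 + 1 / 2 * ‖b‖ ^ 2 := fun a b => by
    rw [norm_mul, RCLike.norm_conj]
    nlinarith [sq_nonneg (‖a‖ - ‖b‖), norm_sub_le a b, norm_nonneg a]
  have hs1 : Summable fun v => 3 / 2 * ‖φ v‖ ^ 2 := hφ.mul_left _
  have hs2 : Summable fun v => 1 / 2 * ‖φ v‖ ^ 2 := hφ.mul_left _
  have sL := G.summable_adj_of_norm_le (F := fun v w => conj (φ v) * (φ v - φ w))
    (g := fun v => 3 / 2 * ‖φ v‖ ^ 2) (h := fun v => 1 / 2 * ‖φ v‖ ^ 2) hD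
    (fun v => by positivity) hs1 (fun v => by positivity) hs2 (fun v w => key (φ v) (φ w))
  have sf := G.summable_adj_of_norm_le
    (F := fun v w => if φ w ≠ φ v then 1 / 2 * ‖φ v‖ ^ 2 else 0)
    (g := fun v => 1 / 2 * ‖φ v‖ ^ 2) (h := fun _ => 0) hD (fun v => by positivity) hs2
    (fun _ => le_rfl) summable_zero (fun v w => by
      have : 0 ≤ 1 / 2 * ‖φ v‖ ^ 2 := by positivity
      split_ifs
      · rw [Real.norm_of_nonneg this, add_zero]
      · rw [norm_zero, add_zero]; exact this)
  have hL := (G.hasSum_sum_neighborFinset (F := fun v w => conj (φ v) * (φ v - φ w)) sL).1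
  have hf := G.hasSum_sum_neighborFinset
    (F := fun v w => if φ w ≠ φ v then 1 / 2 * ‖φ v‖ ^ 2 else 0) sf
  -- The weight `1/2 ‖φ w‖²` at the far end of an edge is moved to the near end by the symmetry of
  -- the sum over ordered edges.
  have hsum := (hf.1.mul_left 3).add hf.2
  have hsum' := (hf.1.mul_left 3).add hf.1
  have hle1 := hasSum_le (fun v => ?_) (Complex.hasSum_re hL) hsum
  have hle2 := hasSum_le (fun v => ?_) hsum' (hφ.hasSum.mul_left c)
  · have : (∑' v, conj (φ v) * ∑ w ∈ G.neighborFinset v, (φ v - φ w)) =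
        ∑' v, ∑ w ∈ G.neighborFinset v, conj (φ v) * (φ v - φ w) :=
      tsum_congr fun v => Finset.mul_sum _ _ _
    rw [this, hL.tsum_eq]
    exact hle1.trans hle2
  · rw [← Finset.sum_filter, Finset.sum_const, nsmul_eq_mul]
    by_cases h0 : φ v = 0
    · simp [h0]
    · have := mul_le_mul_of_nonneg_right (hc v h0) (sq_nonneg ‖φ v‖)
      linarith
  · rw [Complex.re_sum, Finset.mul_sum, ← Finset.sum_add_distrib]
    refine Finset.sum_le_sum fun w _ => ?_
    by_cases h : φ w = φ v
    · simp [h]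
    · rw [if_pos h, if_pos (Ne.symm h)]
      have := (Complex.re_le_norm _).trans (key (φ v) (φ w))
      linarith

end SimpleGraph

namespace RandomComb

/-! ### Geometry of the comb -/

section Geometry

variable {L : ℕ} {χ : ZMod L → Bool}

/-- The vertex `(n, j)` of the tooth at `n`; for `j = 0` it is the spine vertex. -/
def tooth {n : ZMod L} (h : χ n = true) (j : ℕ) : Vertex χ :=
  ⟨(n, j), Or.inr h⟩

theorem tooth_zero {n : ZMod L} (h : χ n = true) : tooth h 0 = spine χ n := rfl

theorem spine_injective : Function.Injective (spine χ) := fun _ _ h =>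
  congrArg (fun v : Vertex χ => v.1.1) h

theorem tooth_injective {n : ZMod L} (h : χ n = true) : Function.Injective (tooth h) := fun _ _ h =>
  congrArg (fun v : Vertex χ => v.1.2) h

theorem eq_spine_or_eq_tooth (v : Vertex χ) :
    (∃ n, v = spine χ n) ∨ ∃ (n : ZMod L) (h : χ n = true) (j : ℕ), v = tooth h (j + 1) := by
  obtain ⟨⟨n, j⟩, hv⟩ := v
  cases j with
  | zero => exact Or.inl ⟨n, rfl⟩
  | succ j =>
    have h : χ n = true := by simpa using hv
    exact Or.inr ⟨n, h, j, rfl⟩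

theorem comb_adj_spine {n : ZMod L} {w : Vertex χ} (hw : (comb χ).Adj (spine χ n) w) :
    w = spine χ (n + 1) ∨ w = spine χ (n - 1) ∨ ∃ h : χ n = true, w = tooth h 1 := by
  obtain ⟨⟨m, k⟩, hv⟩ := w
  obtain ⟨-, ⟨-, h2, h3 | h3⟩ | ⟨h1, h2⟩⟩ := hw
  · exact Or.inl (Subtype.ext (Prod.ext h3 h2))
  · exact Or.inr (Or.inl (Subtype.ext (Prod.ext (eq_sub_of_add_eq h3.symm) h2)))
  · have h1' : n = m := h1
    have h2' : k = 1 := by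
      have : k = 0 + 1 ∨ 0 = k + 1 := h2
      omega
    subst h1' h2'
    have h : χ n = true := by simpa using hv
    exact Or.inr (Or.inr ⟨h, rfl⟩)

theorem comb_adj_tooth {n : ZMod L} (h : χ n = true) (j : ℕ) {w : Vertex χ} :
    (comb χ).Adj (tooth h (j + 1)) w ↔ w = tooth h j ∨ w = tooth h (j + 2) := by
  constructor
  · intro hw
    obtain ⟨⟨m, k⟩, hv⟩ := w
    obtain ⟨-, ⟨h1, -⟩ | ⟨h1, h2⟩⟩ := hw
    · exact absurd h1 (Nat.succ_ne_zero j)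
    · have h1' : n = m := h1
      have h2' : k = j + 1 + 1 ∨ j + 1 = k + 1 := h2
      subst h1'
      rcases h2' with h2 | h2
      · exact Or.inr (Subtype.ext (Prod.ext rfl h2))
      · exact Or.inl (Subtype.ext (Prod.ext rfl (show k = j by omega)))
  · rintro (rfl | rfl)
    · exact ⟨fun he => by have := tooth_injective h he; omega, Or.inr ⟨rfl, Or.inr rfl⟩⟩
    · exact ⟨fun he => by have := tooth_injective h he; omega, Or.inr ⟨rfl, Or.inl rfl⟩⟩

theorem card_neighborFinset_le (v : Vertex χ) : ((comb χ).neighborFinset v).card ≤ 3 := by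
  classical
  rcases eq_spine_or_eq_tooth v with ⟨n, rfl⟩ | ⟨n, h, j, rfl⟩
  · by_cases h : χ n = true
    · refine (Finset.card_le_card (t := {spine χ (n + 1), spine χ (n - 1), tooth h 1})
        fun w hw => ?_).trans Finset.card_le_three
      rw [SimpleGraph.mem_neighborFinset] at hw
      rcases comb_adj_spine hw with rfl | rfl | ⟨h, rfl⟩ <;> simp
    · refine (Finset.card_le_card (t := {spine χ (n + 1), spine χ (n - 1)})
        fun w hw => ?_).trans (Finset.card_le_two.trans (by norm_num))
      rw [SimpleGraph.mem_neighborFinset] at hw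
      rcases comb_adj_spine hw with rfl | rfl | ⟨h', rfl⟩ <;> simp_all
  · refine (Finset.card_le_card (t := {tooth h j, tooth h (j + 2)})
      fun w hw => ?_).trans (Finset.card_le_two.trans (by norm_num))
    rw [SimpleGraph.mem_neighborFinset, comb_adj_tooth] at hw
    simpa using hw

theorem neighborFinset_spine_subset_of_hole [DecidableEq (Vertex χ)] {n : ZMod L}
    (h : χ n = false) :
    (comb χ).neighborFinset (spine χ n) ⊆ {spine χ (n + 1), spine χ (n - 1)} := fun w hw => by
  rw [SimpleGraph.mem_neighborFinset] at hw
  rcases comb_adj_spine hw with rfl | rfl | ⟨h', rfl⟩ <;> simp_all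

/-- Only the roots of the teeth have more than two neighbours, and one of these is discounted as
soon as `φ` agrees there with an adjacent spine vertex. -/
theorem card_filter_neighborFinset_le_two [DecidableEq ℂ] {φ : Vertex χ → ℂ}
    (hφ : ∀ n, χ n = true →
      φ (spine χ (n + 1)) = φ (spine χ n) ∨ φ (spine χ (n - 1)) = φ (spine χ n)) (v : Vertex χ) :
    {w ∈ (comb χ).neighborFinset v | φ w ≠ φ v}.card ≤ 2 := by
  classical
  rcases eq_spine_or_eq_tooth v with ⟨n, rfl⟩ | ⟨n, h, j, rfl⟩
  · by_cases h : χ n = true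
    · rcases hφ n h with h1 | h1
      · refine (Finset.card_le_card (t := {spine χ (n - 1), tooth h 1})
          fun w hw => ?_).trans Finset.card_le_two
        rw [Finset.mem_filter, SimpleGraph.mem_neighborFinset] at hw
        obtain ⟨hw, hne⟩ := hw
        rcases comb_adj_spine hw with rfl | rfl | ⟨h, rfl⟩
        · exact absurd h1 hne
        all_goals simp
      · refine (Finset.card_le_card (t := {spine χ (n + 1), tooth h 1})
          fun w hw => ?_).trans Finset.card_le_two
        rw [Finset.mem_filter, SimpleGraph.mem_neighborFinset] at hw
        obtain ⟨hw, hne⟩ := hw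
        rcases comb_adj_spine hw with rfl | rfl | ⟨h, rfl⟩
        · simp
        · exact absurd h1 hne
        · simp
    · exact (Finset.card_le_card ((Finset.filter_subset _ _).trans
        (neighborFinset_spine_subset_of_hole (by simpa using h)))).trans Finset.card_le_two
  · refine (Finset.card_le_card (t := {tooth h j, tooth h (j + 2)})
      fun w hw => ?_).trans Finset.card_le_two
    rw [Finset.mem_filter, SimpleGraph.mem_neighborFinset, comb_adj_tooth] at hw
    simpa using hw.1

theorem hamiltonian_tooth {n : ZMod L} (h : χ n = true) (j : ℕ) (φ : Vertex χ → ℂ) :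
    hamiltonian χ φ (tooth h (j + 1)) =
      2 * φ (tooth h (j + 1)) - φ (tooth h j) - φ (tooth h (j + 2)) := by
  classical
  have : (comb χ).neighborFinset (tooth h (j + 1)) = {tooth h j, tooth h (j + 2)} := by
    ext w
    rw [SimpleGraph.mem_neighborFinset, comb_adj_tooth]
    simp
  change ∑ w ∈ (comb χ).neighborFinset (tooth h (j + 1)), (φ (tooth h (j + 1)) - φ w) = _
  rw [this, Finset.sum_pair fun he => by have := tooth_injective h he; omega]
  ring

end Geometry

end RandomComb

namespace RandomComb

/-! ### Bound states above the continuum -/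

section BoundStates

variable {L : ℕ} {χ : ZMod L → Bool}

theorem summable_norm_sq (φ : Hilb χ) : Summable fun v => ‖φ v‖ ^ 2 := by
  have h := (lp.memℓp φ).summable (by norm_num)
  simpa using h

theorem norm_sq_eq_tsum (φ : Hilb χ) : ‖φ‖ ^ 2 = ∑' v, ‖φ v‖ ^ 2 := by
  have h := lp.norm_rpow_eq_tsum (p := 2) (by norm_num) φ
  simpa using h

theorem inner_eq_tsum (φ ψ : Hilb χ) : inner ℂ φ ψ = ∑' v, conj (φ v) * ψ v := by
  rw [lp.inner_eq_tsum]
  exact tsum_congr fun v => by rw [RCLike.inner_apply, mul_comm]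

/-- The energy form of `φ` is at most `c ‖φ‖²` if `φ` changes along at most `c / 2` of the edges at
each vertex where it does not vanish. -/
theorem re_inner_hamiltonian_le [DecidableEq ℂ] {φ ψ : Hilb χ}
    (hψ : (ψ : Vertex χ → ℂ) = hamiltonian χ φ) {c : ℝ}
    (hc : ∀ v, φ v ≠ 0 →
      2 * (({w ∈ (comb χ).neighborFinset v | φ w ≠ φ v}.card : ℕ) : ℝ) ≤ c) :
    (inner ℂ φ ψ).re ≤ c * ‖φ‖ ^ 2 := by
  rw [inner_eq_tsum, norm_sq_eq_tsum, hψ]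
  refine (comb χ).re_tsum_conj_laplacian_le card_neighborFinset_le (summable_norm_sq φ)
    fun v hv => ?_
  convert hc v hv

theorem hamiltonian_apply_of_mem {E : ℝ} {φ : Hilb χ} (hφ : φ ∈ energyEigenspace χ E) :
    hamiltonian χ φ = (((E : ℂ) • φ : Hilb χ) : Vertex χ → ℂ) := by
  rw [lp.coeFn_smul]
  exact hφ

theorem orthogonalFamily_energyEigenspace :
    OrthogonalFamily ℂ (fun E : Set.Ioi (4 : ℝ) => energyEigenspace χ E)
      fun E => (energyEigenspace χ (E : ℝ)).subtypeₗᵢ := by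
  refine OrthogonalFamily.of_pairwise fun E E' hne => ?_
  change energyEigenspace χ (E : ℝ) ⟂ energyEigenspace χ (E' : ℝ)
  rw [Submodule.isOrtho_iff_inner_eq]
  intro φ hφ ψ hψ
  have h := (comb χ).tsum_conj_laplacian_symm card_neighborFinset_le (summable_norm_sq φ)
    (summable_norm_sq ψ)
  have h1 : (∑' v, conj (∑ w ∈ (comb χ).neighborFinset v, (φ v - φ w)) * ψ v) =
      inner ℂ (((E : ℝ) : ℂ) • φ) ψ := by
    rw [inner_eq_tsum, ← hamiltonian_apply_of_mem hφ]
    rfl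
  have h2 : (∑' v, conj (φ v) * ∑ w ∈ (comb χ).neighborFinset v, (ψ v - ψ w)) =
      inner ℂ φ (((E' : ℝ) : ℂ) • ψ) := by
    rw [inner_eq_tsum, ← hamiltonian_apply_of_mem hψ]
    rfl
  rw [h1, h2, inner_smul_left, inner_smul_right, Complex.conj_ofReal] at h
  have h3 : (((E : ℝ) : ℂ) - ((E' : ℝ) : ℂ)) * inner ℂ φ ψ = 0 := by rw [sub_mul, h, sub_self]
  refine (mul_eq_zero.mp h3).resolve_left (sub_ne_zero.mpr fun he => hne ?_)
  exact Subtype.ext (Complex.ofReal_injective he)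

theorem energy_le_six {E : ℝ} {φ : Hilb χ} (hφ : φ ∈ energyEigenspace χ E) (h0 : φ ≠ 0) :
    E ≤ 6 := by
  classical
  have h := re_inner_hamiltonian_le (c := 6) (hamiltonian_apply_of_mem hφ).symm fun v _ => by
    have h1 := (Finset.card_filter_le ((comb χ).neighborFinset v) (fun w => φ w ≠ φ v)).trans
      (card_neighborFinset_le v)
    have h2 : (({w ∈ (comb χ).neighborFinset v | φ w ≠ φ v}.card : ℕ) : ℝ) ≤ 3 := by
      exact_mod_cast h1
    linarith
  rw [inner_smul_right, Complex.re_ofReal_mul, ← RCLike.re_eq_complex_re,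
    inner_self_eq_norm_sq] at h
  exact le_of_mul_le_mul_right h (by positivity)

/-- The differences `φ (n, 0) - φ (n + 1, 0)` at the sites `n ∈ A`. -/
noncomputable def spineDiff (χ : ZMod L → Bool) (A : Finset (ZMod L)) :
    Hilb χ →ₗ[ℂ] (A → ℂ) where
  toFun φ n := φ (spine χ (n : ZMod L)) - φ (spine χ ((n : ZMod L) + 1))
  map_add' φ ψ := by
    ext n
    change (φ (spine χ n) + ψ (spine χ n)) - (φ (spine χ (n + 1)) + ψ (spine χ (n + 1))) =
      (φ (spine χ n) - φ (spine χ (n + 1))) + (ψ (spine χ n) - ψ (spine χ (n + 1)))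
    ring
  map_smul' c φ := by
    ext n
    exact (mul_sub c (φ (spine χ n)) (φ (spine χ (n + 1)))).symm

theorem inner_sum_energyEigenspace {f g : Set.Ioi (4 : ℝ) → Hilb χ}
    (hf : ∀ E : Set.Ioi (4 : ℝ), f E ∈ energyEigenspace χ E)
    (hg : ∀ E : Set.Ioi (4 : ℝ), g E ∈ energyEigenspace χ E)
    (s : Finset (Set.Ioi (4 : ℝ))) :
    inner ℂ (∑ E ∈ s, f E) (∑ E ∈ s, g E) = ∑ E ∈ s, inner ℂ (f E) (g E) :=
  (orthogonalFamily_energyEigenspace (χ := χ)).inner_sum (fun E => ⟨f E, hf E⟩)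
    (fun E => ⟨g E, hg E⟩) s

/-- If every tooth root is an end of one of the spine edges `{n, n + 1}`, `n ∈ A`, then equal values
at the ends of these edges force the energy form to be at most `4 ‖φ‖²`. On a combination of
eigenfunctions with energies above `4` it is larger than that, unless `φ = 0`. -/
theorem eq_zero_of_spineDiff_eq_zero {A : Finset (ZMod L)}
    (hA : ∀ n, χ n = true → n ∈ A ∨ n - 1 ∈ A) {φ : Hilb χ}
    (hφ : φ ∈ ⨆ E : Set.Ioi (4 : ℝ), energyEigenspace χ E) (h0 : spineDiff χ A φ = 0) :
    φ = 0 := by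
  classical
  obtain ⟨f, hf, hsum⟩ := (Submodule.mem_iSup_iff_exists_finsupp _ _).mp hφ
  replace hsum : ∑ E ∈ f.support, f E = φ := hsum
  set ψ : Hilb χ := ∑ E ∈ f.support, (((E : ℝ) : ℂ) • f E : Hilb χ) with hψ
  have hHψ : (ψ : Vertex χ → ℂ) = hamiltonian χ φ := by
    rw [hψ, ← hsum, lp.coeFn_sum, lp.coeFn_sum, map_sum]
    exact Finset.sum_congr rfl fun E _ => (hamiltonian_apply_of_mem (hf E)).symm
  have hdiff : ∀ n ∈ A, φ (spine χ n) = φ (spine χ (n + 1)) := fun n hn =>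
    sub_eq_zero.mp (congrFun h0 ⟨n, hn⟩)
  have hle := re_inner_hamiltonian_le (c := 4) hHψ fun v _ => by
    have h1 := card_filter_neighborFinset_le_two (φ := (φ : Vertex χ → ℂ)) (fun n hn => by
      rcases hA n hn with h | h
      · exact Or.inl (hdiff n h).symm
      · right
        have := hdiff _ h
        rwa [sub_add_cancel] at this) v
    have h2 : (({w ∈ (comb χ).neighborFinset v | φ w ≠ φ v}.card : ℕ) : ℝ) ≤ 2 := by
      exact_mod_cast h1
    linarith
  have hφψ : inner ℂ φ ψ = ∑ E ∈ f.support, ((E : ℝ) : ℂ) * inner ℂ (f E) (f E) := by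
    have h := inner_sum_energyEigenspace hf
      (g := fun E => ((E : ℝ) : ℂ) • f E)
      (fun E => Submodule.smul_mem _ ((E : ℝ) : ℂ) (hf E)) f.support
    simp only [inner_smul_right] at h
    rw [← h, ← hsum]
  have hφφ : inner ℂ φ φ = ∑ E ∈ f.support, inner ℂ (f E) (f E) := by
    rw [← inner_sum_energyEigenspace hf hf, hsum]
  have hre : ∀ E, (inner ℂ (f E) (f E) : ℂ).re = ‖f E‖ ^ 2 := fun E =>
    inner_self_eq_norm_sq (𝕜 := ℂ) _
  have hn : ‖φ‖ ^ 2 = ∑ E ∈ f.support, ‖f E‖ ^ 2 := by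
    rw [← inner_self_eq_norm_sq (𝕜 := ℂ), hφφ, RCLike.re_eq_complex_re, Complex.re_sum]
    exact Finset.sum_congr rfl fun E _ => hre E
  rw [hφψ, Complex.re_sum, hn, Finset.mul_sum] at hle
  by_contra hne
  have hsupp : f.support.Nonempty := by
    rw [Finset.nonempty_iff_ne_empty]
    rintro he
    exact hne (by rw [← hsum, he, Finset.sum_empty])
  refine absurd hle (not_le.mpr (Finset.sum_lt_sum_of_nonempty hsupp fun E hE => ?_))
  rw [Complex.re_ofReal_mul, hre]
  have : 0 < ‖f E‖ ^ 2 := by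
    have := norm_pos_iff.mpr (Finsupp.mem_support_iff.mp hE)
    positivity
  exact mul_lt_mul_of_pos_right E.2 this

theorem finiteDimensional_iSup_energyEigenspace {A : Finset (ZMod L)}
    (hA : ∀ n, χ n = true → n ∈ A ∨ n - 1 ∈ A) :
    FiniteDimensional ℂ (⨆ E : Set.Ioi (4 : ℝ), energyEigenspace χ E : Submodule ℂ (Hilb χ)) ∧
      Module.finrank ℂ (⨆ E : Set.Ioi (4 : ℝ), energyEigenspace χ E : Submodule ℂ (Hilb χ)) ≤
        A.card := by
  have hinj : Function.Injective
      ((spineDiff χ A).domRestrict (⨆ E : Set.Ioi (4 : ℝ), energyEigenspace χ E)) := by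
    rw [injective_iff_map_eq_zero]
    exact fun φ h => Subtype.ext (eq_zero_of_spineDiff_eq_zero hA φ.2 h)
  refine ⟨Module.Finite.of_injective _ hinj, ?_⟩
  simpa using LinearMap.finrank_le_finrank_of_injective hinj

/-- The bound states are spanned by at most `|A|` orthonormal eigenfunctions. -/
theorem exists_orthonormal_eigenfunctions {A : Finset (ZMod L)}
    (hA : ∀ n, χ n = true → n ∈ A ∨ n - 1 ∈ A) :
    ∃ (ι : Type) (_ : Fintype ι) (Γ : ι → Hilb χ) (E : ι → Set.Ioi (4 : ℝ)), Orthonormal ℂ Γ ∧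
      (∀ σ, Γ σ ∈ energyEigenspace χ (E σ)) ∧ Fintype.card ι ≤ A.card ∧
      Submodule.span ℂ (Set.range Γ) = ⨆ E : Set.Ioi (4 : ℝ), energyEigenspace χ E := by
  obtain ⟨hfd, hrank⟩ := finiteDimensional_iSup_energyEigenspace hA
  have hEW : ∀ E : Set.Ioi (4 : ℝ),
      energyEigenspace χ E ≤ ⨆ E : Set.Ioi (4 : ℝ), energyEigenspace χ E := fun E =>
    le_iSup (fun E : Set.Ioi (4 : ℝ) => energyEigenspace χ E) E
  have hfd : ∀ E : Set.Ioi (4 : ℝ), FiniteDimensional ℂ (energyEigenspace χ E) := fun E =>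
    Submodule.finiteDimensional_of_le (hEW E)
  have hb : ∀ E : Set.Ioi (4 : ℝ), ∃ (d : ℕ) (b : Fin d → energyEigenspace χ E),
      Orthonormal ℂ b ∧ Submodule.span ℂ (Set.range b) = ⊤ := fun E => by
    refine ⟨_, stdOrthonormalBasis ℂ (energyEigenspace χ E), OrthonormalBasis.orthonormal _, ?_⟩
    rw [← OrthonormalBasis.coe_toBasis]
    exact Module.Basis.span_eq _
  choose d b hbo hbs using hb
  have hΓ : Orthonormal ℂ fun σ : Σ E : Set.Ioi (4 : ℝ), Fin (d E) => (b σ.1 σ.2 : Hilb χ) :=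
    (orthogonalFamily_energyEigenspace (χ := χ)).orthonormal_sigma_orthonormal hbo
  have hli := (hΓ.codRestrict (⨆ E : Set.Ioi (4 : ℝ), energyEigenspace χ E)
    fun σ => hEW σ.1 (b σ.1 σ.2).2).linearIndependent
  have hfin := hli.finite
  have hft := Fintype.ofFinite (Σ E : Set.Ioi (4 : ℝ), Fin (d E))
  refine ⟨_, hft, _, fun σ => σ.1, hΓ, fun σ => (b σ.1 σ.2).2,
    hli.fintype_card_le_finrank.trans hrank, le_antisymm ?_ (iSup_le fun E φ hφ => ?_)⟩
  · rw [Submodule.span_le]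
    rintro _ ⟨σ, rfl⟩
    exact hEW σ.1 (b σ.1 σ.2).2
  · have h1 : (⟨φ, hφ⟩ : energyEigenspace χ E) ∈ Submodule.span ℂ (Set.range (b E)) := by
      rw [hbs]
      trivial
    have h2 := Submodule.mem_map_of_mem (f := (energyEigenspace χ (E : ℝ)).subtype) h1
    rw [Submodule.map_span] at h2
    refine Submodule.span_mono ?_ h2
    rintro _ ⟨_, ⟨i, rfl⟩, rfl⟩
    exact ⟨⟨E, i⟩, rfl⟩

theorem Ploc_eq_sum {ι : Type} [Fintype ι] {Γ : ι → Hilb χ} (hΓ : Orthonormal ℂ Γ)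
    (hspan : Submodule.span ℂ (Set.range Γ) = ⨆ E : Set.Ioi (4 : ℝ), energyEigenspace χ E)
    (n : ZMod L) : Ploc χ n = ∑ σ, ‖Γ σ (spine χ n)‖ ^ 2 := by
  classical
  have hloc : locSubspace χ = Submodule.span ℂ (Set.range Γ) := by
    rw [locSubspace, ← hspan]
    have : FiniteDimensional ℂ (Submodule.span ℂ (Set.range Γ)) :=
      FiniteDimensional.span_of_finite ℂ (Set.finite_range Γ)
    exact (Submodule.closed_of_finiteDimensional _).submodule_topologicalClosure_eq
  have hmem : ∀ σ, Γ σ ∈ locSubspace χ := fun σ => by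
    rw [hloc]
    exact Submodule.subset_span ⟨σ, rfl⟩
  have htop : ⊤ ≤ (Submodule.span ℂ
      (Set.range (Set.codRestrict Γ (locSubspace χ) hmem))).topologicalClosure := by
    refine le_trans ?_ (Submodule.le_topologicalClosure _)
    rintro ⟨φ, hφ⟩ -
    have h1 : φ ∈ Submodule.span ℂ (Set.range Γ) := by rwa [hloc] at hφ
    have h2 : Set.range Γ =
        (locSubspace χ).subtype '' Set.range (Set.codRestrict Γ (locSubspace χ) hmem) := by
      rw [← Set.range_comp]
      rfl
    rw [h2, ← Submodule.map_span] at h1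
    obtain ⟨φ', hφ', he⟩ := h1
    rwa [show φ' = ⟨φ, hφ⟩ from Subtype.ext he] at hφ'
  have hB := hasSum_Ploc χ n (HilbertBasis.mk (hΓ.codRestrict _ hmem) htop)
  rw [hB.unique (hasSum_fintype _), HilbertBasis.coe_mk]
  refine Finset.sum_congr rfl fun σ _ => ?_
  rw [Set.val_codRestrict_apply, initialState, lp.inner_single_right, RCLike.inner_apply, one_mul,
    RCLike.norm_conj]

/-- The spine mass of a state. -/
noncomputable def spineMass [NeZero L] (φ : Hilb χ) : ℝ := ∑ n, ‖φ (spine χ n)‖ ^ 2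

/-- The sum of the localization probabilities over the spine is the sum of the spine masses of at
most `|A|` orthonormal bound states. -/
theorem sum_Ploc_le [NeZero L] {A : Finset (ZMod L)}
    (hA : ∀ n, χ n = true → n ∈ A ∨ n - 1 ∈ A) {c : ℝ} (hc0 : 0 ≤ c)
    (hc : ∀ E : ℝ, 4 < E → ∀ φ ∈ energyEigenspace χ E, ‖φ‖ = 1 → spineMass φ ≤ c) :
    ∑ n, Ploc χ n ≤ c * (A.card : ℝ) := by
  obtain ⟨ι, _, Γ, E, hΓ, hΓE, hcard, hspan⟩ := exists_orthonormal_eigenfunctions hA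
  calc ∑ n, Ploc χ n = ∑ σ, spineMass (Γ σ) := by
        simp only [Ploc_eq_sum hΓ hspan, spineMass]
        exact Finset.sum_comm
    _ ≤ ∑ _σ : ι, c :=
        Finset.sum_le_sum fun σ _ => hc _ (E σ).2 _ (hΓE σ) (hΓ.1 σ)
    _ ≤ c * (A.card : ℝ) := by
        rw [Finset.sum_const, Finset.card_univ, nsmul_eq_mul, mul_comm]
        exact mul_le_mul_of_nonneg_left (by exact_mod_cast hcard) hc0

/-! ### Mass of a bound state on the teeth -/

/-- A bound state has a fixed fraction of its mass on the first two vertices of the teeth. -/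
theorem sum_tooth_root_le [NeZero L] {E : ℝ} (hE : 4 < E) {φ : Hilb χ}
    (hφ : φ ∈ energyEigenspace χ E) (h1 : ‖φ‖ = 1) :
    ∑ n : {n // χ n = true}, ‖φ (spine χ n)‖ ^ 2 ≤ 17 * (1 - spineMass φ) := by
  have hE6 := energy_le_six hφ (norm_ne_zero_iff.mp (by rw [h1]; exact one_ne_zero))
  have hroot : ∀ n : {n // χ n = true}, ‖φ (spine χ n)‖ ^ 2 ≤
      17 * (‖φ (tooth n.2 1)‖ ^ 2 + ‖φ (tooth n.2 2)‖ ^ 2) := fun n => by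
    have h := congrFun hφ (tooth n.2 (0 + 1))
    rw [hamiltonian_tooth, tooth_zero, Pi.smul_apply, smul_eq_mul] at h
    have h' : φ (spine χ n) = ((2 - E : ℝ) : ℂ) * φ (tooth n.2 1) - φ (tooth n.2 2) := by
      push_cast
      linear_combination -h
    have hle := norm_sub_le (((2 - E : ℝ) : ℂ) * φ (tooth n.2 1)) (φ (tooth n.2 2))
    rw [← h', norm_mul, Complex.norm_real, Real.norm_eq_abs, abs_of_neg (by linarith)] at hle
    have ha := norm_nonneg (φ (tooth n.2 1))
    -- `|2 - E| ≤ 4`, and then Cauchy-Schwarz with `4 ^ 2 + 1 = 17`.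
    have hle' : ‖φ (spine χ n)‖ ≤ 4 * ‖φ (tooth n.2 1)‖ + ‖φ (tooth n.2 2)‖ := by nlinarith
    nlinarith [sq_nonneg (‖φ (tooth n.2 1)‖ - 4 * ‖φ (tooth n.2 2)‖), norm_nonneg (φ (spine χ n))]
  let g : ZMod L ⊕ ({n // χ n = true} × Fin 2) → Vertex χ :=
    Sum.elim (spine χ) fun x => tooth x.1.2 (x.2 + 1)
  have hg : Function.Injective g := by
    refine spine_injective.sumElim ?_ ?_
    · rintro ⟨n, i⟩ ⟨m, j⟩ h
      have h1 : (n : ZMod L) = m := congrArg (fun v : Vertex χ => v.1.1) h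
      have h2 : (i : ℕ) + 1 = j + 1 := congrArg (fun v : Vertex χ => v.1.2) h
      exact Prod.ext (Subtype.ext h1) (Fin.ext (Nat.succ_injective h2))
    · rintro n ⟨m, j⟩ h
      have h2 : 0 = (j : ℕ) + 1 := congrArg (fun v : Vertex χ => v.1.2) h
      omega
  have hle := tsum_comp_le_tsum_of_inj (summable_norm_sq φ) (fun v => sq_nonneg _) hg
  rw [← norm_sq_eq_tsum, h1, tsum_fintype, Fintype.sum_sum_type, Fintype.sum_prod_type] at hle
  simp only [Function.comp, g, Sum.elim_inl, Sum.elim_inr, Fin.sum_univ_two, Fin.val_zero,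
    Fin.val_one, zero_add, one_add_one_eq_two] at hle
  calc _ ≤ ∑ n : {n // χ n = true}, 17 * (‖φ (tooth n.2 1)‖ ^ 2 + ‖φ (tooth n.2 2)‖ ^ 2) :=
        Finset.sum_le_sum fun n _ => hroot n
    _ ≤ _ := by
        rw [← Finset.mul_sum, spineMass]
        linarith

/-- Maximum principle: at a hole the eigenvalue equation with `E > 4` reads
`(E - d) φ v = -∑ φ w` with `d ≤ 2` neighbours, so `|φ|` is largest at a tooth root. -/
theorem spineMass_le_mul_sum_tooth_root [NeZero L] {E : ℝ} (hE : 4 < E) {φ : Hilb χ}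
    (hφ : φ ∈ energyEigenspace χ E) :
    spineMass φ ≤ L * ∑ n : {n // χ n = true}, ‖φ (spine χ n)‖ ^ 2 := by
  classical
  obtain ⟨m, hm⟩ := Finite.exists_max fun n => ‖φ (spine χ n)‖
  have hS : spineMass φ ≤ L * ‖φ (spine χ m)‖ ^ 2 := by
    refine (Finset.sum_le_card_nsmul Finset.univ _ (‖φ (spine χ m)‖ ^ 2) fun n _ => ?_).trans_eq ?_
    · exact pow_le_pow_left₀ (norm_nonneg _) (hm n) 2
    · rw [Finset.card_univ, ZMod.card, nsmul_eq_mul]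
  refine hS.trans (mul_le_mul_of_nonneg_left ?_ (Nat.cast_nonneg L))
  by_cases hχ : χ m = true
  · exact Finset.single_le_sum (f := fun n : {n // χ n = true} => ‖φ (spine χ n)‖ ^ 2)
      (fun n _ => sq_nonneg _) (Finset.mem_univ ⟨m, hχ⟩)
  · suffices h : φ (spine χ m) = 0 by
      rw [h, norm_zero, zero_pow two_ne_zero]
      exact Finset.sum_nonneg fun n _ => sq_nonneg _
    have hsub := neighborFinset_spine_subset_of_hole (by simpa using hχ : χ m = false)
    set N := (comb χ).neighborFinset (spine χ m) with hN
    have hcard : (N.card : ℝ) ≤ 2 := by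
      exact_mod_cast (Finset.card_le_card hsub).trans Finset.card_le_two
    have h : ∑ w ∈ N, (φ (spine χ m) - φ w) = (E : ℂ) * φ (spine χ m) := congrFun hφ (spine χ m)
    rw [Finset.sum_sub_distrib, Finset.sum_const, nsmul_eq_mul] at h
    have h' : ((E - N.card : ℝ) : ℂ) * φ (spine χ m) = -∑ w ∈ N, φ w := by
      push_cast
      linear_combination -h
    have h2 := congrArg norm h'
    rw [norm_mul, Complex.norm_real, Real.norm_of_nonneg (by linarith), norm_neg] at h2
    have h3 : ‖∑ w ∈ N, φ w‖ ≤ N.card * ‖φ (spine χ m)‖ := by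
      refine (norm_sum_le_of_le N fun w hw => ?_).trans_eq
        (by rw [Finset.sum_const, nsmul_eq_mul])
      have hw' := hsub hw
      rw [Finset.mem_insert, Finset.mem_singleton] at hw'
      rcases hw' with rfl | rfl
      exacts [hm _, hm _]
    rw [← norm_le_zero_iff]
    nlinarith [norm_nonneg (φ (spine χ m))]

theorem spineMass_le [NeZero L] {K : ℝ} (hK : 0 ≤ K) {E : ℝ} (hE : 4 < E) {φ : Hilb χ}
    (hφ : φ ∈ energyEigenspace χ E) (h1 : ‖φ‖ = 1)
    (hT : spineMass φ ≤ K * ∑ n : {n // χ n = true}, ‖φ (spine χ n)‖ ^ 2) :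
    spineMass φ ≤ 17 * K / (1 + 17 * K) := by
  rw [le_div_iff₀ (by positivity)]
  have := mul_le_mul_of_nonneg_left (sum_tooth_root_le hE hφ h1) hK
  linarith

end BoundStates

end RandomComb

namespace RandomComb

/-! ### Translation of the comb -/

section Translation

variable {L : ℕ}

/-- Translation by `k` along the spine. -/
def shiftEquiv (χ : ZMod L → Bool) (k : ZMod L) :
    Vertex (fun n => χ (n + k)) ≃ Vertex χ where
  toFun v := ⟨(v.1.1 + k, v.1.2), v.2⟩
  invFun v := ⟨(v.1.1 - k, v.1.2), by
    change v.1.2 = 0 ∨ χ (v.1.1 - k + k) = true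
    rw [sub_add_cancel]
    exact v.2⟩
  left_inv v := Subtype.ext (Prod.ext (add_sub_cancel_right _ _) rfl)
  right_inv v := Subtype.ext (Prod.ext (sub_add_cancel _ _) rfl)

theorem comb_adj_shiftEquiv (χ : ZMod L → Bool) (k : ZMod L)
    (v w : Vertex (fun n => χ (n + k))) :
    (comb χ).Adj (shiftEquiv χ k v) (shiftEquiv χ k w) ↔
      (comb fun n => χ (n + k)).Adj v w := by
  have h1 : w.1.1 + k = v.1.1 + k + 1 ↔ w.1.1 = v.1.1 + 1 := by
    rw [add_right_comm, add_left_inj]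
  have h2 : v.1.1 + k = w.1.1 + k + 1 ↔ v.1.1 = w.1.1 + 1 := by
    rw [add_right_comm, add_left_inj]
  simp only [comb, shiftEquiv, ne_eq, Equiv.coe_fn_mk, add_left_inj, h1, h2, Subtype.ext_iff,
    Prod.ext_iff]

theorem hamiltonian_comp_shiftEquiv (χ : ZMod L → Bool) (k : ZMod L) (φ : Vertex χ → ℂ)
    (v : Vertex (fun n => χ (n + k))) :
    hamiltonian (fun n => χ (n + k)) (φ ∘ shiftEquiv χ k) v =
      hamiltonian χ φ (shiftEquiv χ k v) := by
  refine Finset.sum_equiv (shiftEquiv χ k) (fun w => ?_) fun w _ => rfl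
  rw [SimpleGraph.mem_neighborFinset, SimpleGraph.mem_neighborFinset, comb_adj_shiftEquiv]

/-- Reindexing of square summable families along a bijection. -/
noncomputable def lpReindex {α β : Type*} (e : α ≃ β) :
    lp (fun _ : β => ℂ) 2 ≃ₗᵢ[ℂ] lp (fun _ : α => ℂ) 2 where
  toFun f := ⟨f ∘ e, memℓp_gen ((e.summable_iff (f := fun b => ‖f b‖ ^ (2 : ENNReal).toReal)).mpr
    ((lp.memℓp f).summable (by norm_num)))⟩
  invFun f := ⟨f ∘ e.symm,
    memℓp_gen ((e.symm.summable_iff (f := fun b => ‖f b‖ ^ (2 : ENNReal).toReal)).mpr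
      ((lp.memℓp f).summable (by norm_num)))⟩
  left_inv f := by
    ext b
    exact congrArg f (e.apply_symm_apply b)
  right_inv f := by
    ext b
    exact congrArg f (e.symm_apply_apply b)
  map_add' f g := rfl
  map_smul' c f := rfl
  norm_map' f := by
    refine Real.rpow_left_injOn (x := (2 : ENNReal).toReal) (by norm_num) (norm_nonneg _)
      (norm_nonneg _) ?_
    dsimp only
    rw [lp.norm_rpow_eq_tsum (by norm_num), lp.norm_rpow_eq_tsum (by norm_num)]
    exact e.tsum_eq fun b => ‖f b‖ ^ (2 : ENNReal).toReal

theorem lpReindex_apply {α β : Type*} (e : α ≃ β) (f : lp (fun _ : β => ℂ) 2) (a : α) :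
    lpReindex e f a = f (e a) := rfl

theorem map_energyEigenspace (χ : ZMod L → Bool) (k : ZMod L) (E : ℝ) :
    (energyEigenspace χ E).map (lpReindex (shiftEquiv χ k)).toLinearEquiv.toLinearMap =
      energyEigenspace (fun n => χ (n + k)) E := by
  ext φ
  constructor
  · rintro ⟨φ, hφ, rfl⟩
    ext v
    exact (hamiltonian_comp_shiftEquiv χ k φ v).trans (congrFun hφ (shiftEquiv χ k v))
  · intro hφ
    refine ⟨(lpReindex (shiftEquiv χ k)).symm φ, ?_, LinearIsometryEquiv.apply_symm_apply _ _⟩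
    ext v
    obtain ⟨v, rfl⟩ := (shiftEquiv χ k).surjective v
    rw [← hamiltonian_comp_shiftEquiv]
    have h : ((lpReindex (shiftEquiv χ k)).symm φ : Vertex χ → ℂ) ∘ shiftEquiv χ k = φ :=
      congrArg (fun f : Hilb (fun n => χ (n + k)) => (f : Vertex (fun n => χ (n + k)) → ℂ))
        ((lpReindex (shiftEquiv χ k)).apply_symm_apply φ)
    rw [h]
    refine (congrFun hφ v).trans ?_
    rw [Pi.smul_apply, Pi.smul_apply]
    exact congrArg _ (congrFun h v).symm

theorem map_locSubspace (χ : ZMod L → Bool) (k : ZMod L) :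
    (locSubspace χ).map (lpReindex (shiftEquiv χ k)).toLinearEquiv.toLinearMap =
      locSubspace (fun n => χ (n + k)) := by
  have h : (⨆ E : Set.Ioi (4 : ℝ), energyEigenspace χ E).map
      (lpReindex (shiftEquiv χ k)).toLinearEquiv.toLinearMap =
      ⨆ E : Set.Ioi (4 : ℝ), energyEigenspace (fun n => χ (n + k)) E := by
    rw [Submodule.map_iSup]
    exact iSup_congr fun E => map_energyEigenspace χ k E
  refine SetLike.coe_injective ?_
  rw [locSubspace, locSubspace, ← h, Submodule.map_coe, Submodule.topologicalClosure_coe,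
    Submodule.topologicalClosure_coe, Submodule.map_coe]
  exact (lpReindex (shiftEquiv χ k)).toHomeomorph.image_closure _

theorem Ploc_shift (χ : ZMod L → Bool) (k n : ZMod L) :
    Ploc (fun m => χ (m + k)) n = Ploc χ (n + k) := by
  classical
  have hi : (lpReindex (shiftEquiv χ k)).symm (initialState (fun m => χ (m + k)) n) =
      initialState χ (n + k) := by
    rw [LinearIsometryEquiv.symm_apply_eq]
    ext v
    rw [lpReindex_apply, initialState, initialState, lp.single_apply, lp.single_apply,
      Pi.single_apply, Pi.single_apply]
    have : shiftEquiv χ k v = spine χ (n + k) ↔ v = spine (fun m => χ (m + k)) n :=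
      (shiftEquiv χ k).apply_eq_iff_eq (y := spine (fun m => χ (m + k)) n)
    simp only [this]
  have h := Submodule.starProjection_map_apply (lpReindex (shiftEquiv χ k)) (locSubspace χ)
    (initialState (fun m => χ (m + k)) n)
  rw [hi] at h
  have h2 : ∀ (U : Submodule ℂ (Hilb fun m => χ (m + k))) [U.HasOrthogonalProjection],
      (locSubspace χ).map (lpReindex (shiftEquiv χ k)).toLinearEquiv.toLinearMap = U →
      ‖U.starProjection (initialState (fun m => χ (m + k)) n)‖ =
        ‖(locSubspace χ).starProjection (initialState χ (n + k))‖ := by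
    rintro U _ rfl
    rw [← LinearIsometryEquiv.norm_map (lpReindex (shiftEquiv χ k)), ← h]
  rw [Ploc, Ploc, h2 _ (map_locSubspace χ k)]

/-- The average of the localization probability does not depend on the starting point. -/
theorem mul_disorderAverage_Ploc [NeZero L] (p : ℝ) (n₀ : ZMod L) :
    L * disorderAverage p (fun χ : ZMod L → Bool => Ploc χ n₀) =
      disorderAverage p (fun χ : ZMod L → Bool => ∑ n, Ploc χ n) := by
  have h : ∀ n : ZMod L, disorderAverage p (fun χ : ZMod L → Bool => Ploc χ n) =
      disorderAverage p (fun χ : ZMod L → Bool => Ploc χ n₀) := fun n => by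
    refine Finset.sum_equiv ((Equiv.addRight (n - n₀)).symm.arrowCongr (Equiv.refl Bool))
      (fun _ => by simp) fun χ _ => ?_
    change configProb p χ * Ploc χ n =
      configProb p (fun m => χ (m + (n - n₀))) * Ploc (fun m => χ (m + (n - n₀))) n₀
    rw [Ploc_shift, add_sub_cancel]
    congr 1
    exact (Equiv.prod_comp (Equiv.addRight (n - n₀)) fun m => if χ m = true then 1 - p else p).symm
  have h2 : disorderAverage p (fun χ : ZMod L → Bool => ∑ n, Ploc χ n) =
      ∑ n, disorderAverage p (fun χ : ZMod L → Bool => Ploc χ n) := by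
    simp only [disorderAverage, Finset.mul_sum]
    exact Finset.sum_comm
  rw [h2, Finset.sum_congr rfl fun n _ => h n, Finset.sum_const, Finset.card_univ, ZMod.card,
    nsmul_eq_mul]

end Translation

end RandomComb

namespace RandomComb

/-! ### The average over the disorder -/

section Disorder

variable {L : ℕ}

theorem configProb_nonneg [NeZero L] {p : ℝ} (hp0 : 0 ≤ p) (hp1 : p ≤ 1) (χ : ZMod L → Bool) :
    0 ≤ configProb p χ :=
  Finset.prod_nonneg fun n _ => by
    split_ifs
    exacts [sub_nonneg.mpr hp1, hp0]

theorem disorderAverage_mono [NeZero L] {p : ℝ} (hp0 : 0 ≤ p) (hp1 : p ≤ 1)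
    {f g : (ZMod L → Bool) → ℝ} (h : ∀ χ, f χ ≤ g χ) :
    disorderAverage p f ≤ disorderAverage p g :=
  Finset.sum_le_sum fun χ _ => mul_le_mul_of_nonneg_left (h χ) (configProb_nonneg hp0 hp1 χ)

theorem disorderAverage_const_mul [NeZero L] (p c : ℝ) (f : (ZMod L → Bool) → ℝ) :
    disorderAverage p (fun χ => c * f χ) = c * disorderAverage p f := by
  simp only [disorderAverage, Finset.mul_sum]
  exact Finset.sum_congr rfl fun χ _ => mul_left_comm _ _ _

theorem disorderAverage_add [NeZero L] (p : ℝ) (f g : (ZMod L → Bool) → ℝ) :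
    disorderAverage p (fun χ => f χ + g χ) = disorderAverage p f + disorderAverage p g := by
  simp only [disorderAverage, mul_add, Finset.sum_add_distrib]

theorem disorderAverage_sub [NeZero L] (p : ℝ) (f g : (ZMod L → Bool) → ℝ) :
    disorderAverage p (fun χ => f χ - g χ) = disorderAverage p f - disorderAverage p g := by
  simp only [disorderAverage, mul_sub, Finset.sum_sub_distrib]

theorem disorderAverage_one [NeZero L] (p : ℝ) :
    disorderAverage p (fun _ : ZMod L → Bool => 1) = 1 := by
  have h := Finset.prod_univ_sum (fun _ : ZMod L => (Finset.univ : Finset Bool))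
    (fun _ b => if b = true then 1 - p else p)
  rw [Fintype.piFinset_univ] at h
  simp only [disorderAverage, configProb, mul_one]
  rw [← h]
  simp

/-- Without holes only the full comb contributes. -/
theorem disorderAverage_zero [NeZero L] (f : (ZMod L → Bool) → ℝ) :
    disorderAverage 0 f = f fun _ => true := by
  rw [disorderAverage, Finset.sum_eq_single fun _ => true]
  · simp [configProb]
  · intro χ _ hχ
    obtain ⟨n, hn⟩ := Function.ne_iff.mp hχ
    rw [configProb, Finset.prod_eq_zero (Finset.mem_univ n) (if_neg hn), zero_mul]
  · simp

theorem configProb_update [NeZero L] (p : ℝ) (χ : ZMod L → Bool) (n : ZMod L) (b : Bool) :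
    configProb p (Function.update χ n b) = (if b = true then 1 - p else p) *
      ∏ m ∈ Finset.univ.erase n, if χ m = true then 1 - p else p := by
  rw [configProb, ← Finset.mul_prod_erase _ _ (Finset.mem_univ n), Function.update_self]
  congr 1
  refine Finset.prod_congr rfl fun m hm => ?_
  rw [Function.update_of_ne (Finset.ne_of_mem_erase hm)]

/-- The presence of a tooth at `n` is independent of the rest of the comb. -/
theorem disorderAverage_ite_tooth [NeZero L] (p : ℝ) (n : ZMod L) {f : (ZMod L → Bool) → ℝ}
    (hf : ∀ χ b, f (Function.update χ n b) = f χ) :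
    disorderAverage p (fun χ => if χ n = true then f χ else 0) = (1 - p) * disorderAverage p f := by
  have hinv : Function.Involutive fun χ : ZMod L → Bool => Function.update χ n (!χ n) :=
    fun χ => by simp
  -- Switching the tooth at `n` exchanges the two alternatives.
  have hflip : p * disorderAverage p (fun χ => if χ n = true then f χ else 0) =
      (1 - p) * disorderAverage p (fun χ => if χ n = true then 0 else f χ) := by
    simp only [disorderAverage, Finset.mul_sum]
    refine Finset.sum_equiv hinv.toPerm (fun _ => by simp) fun χ _ => ?_
    simp only [Function.Involutive.coe_toPerm, Function.update_self, hf, configProb_update]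
    nth_rewrite 1 [← Function.update_eq_self n χ]
    rw [configProb_update]
    cases χ n <;> simp
    ring
  have hadd := disorderAverage_add p (fun χ : ZMod L → Bool => if χ n = true then f χ else 0)
    (fun χ => if χ n = true then 0 else f χ)
  have hsum : (fun χ : ZMod L → Bool => (if χ n = true then f χ else 0) +
      (if χ n = true then 0 else f χ)) = f := by
    ext χ
    split_ifs <;> simp
  rw [hsum] at hadd
  linear_combination hflip - (1 - p) * hadd

/-- Alternating selection of teeth: a tooth is selected if its left neighbour is not, where the
selection looks at `k` sites only. Within a run of teeth that starts less than `k` sites to the left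
of `n` the selected ones are the first, the third, and so on. -/
def altSelect (χ : ZMod L → Bool) : ℕ → ZMod L → Bool
  | 0, _ => false
  | k + 1, n => χ n && !altSelect χ k (n - 1)

theorem altSelect_update (χ : ZMod L → Bool) (n : ZMod L) (b : Bool) (k : ℕ) (m : ZMod L)
    (h : ∀ i < k, m - (i : ZMod L) ≠ n) :
    altSelect (Function.update χ n b) k m = altSelect χ k m := by
  induction k generalizing m with
  | zero => rfl
  | succ k ih =>
    have h0 : m ≠ n := by simpa using h 0 k.succ_pos
    rw [altSelect, altSelect, Function.update_of_ne h0, ih]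
    intro i hi
    have := h (i + 1) (by omega)
    rwa [Nat.cast_succ, add_comm, ← sub_sub] at this

theorem altSelect_update_pred (χ : ZMod L → Bool) (n : ZMod L) (b : Bool) {k : ℕ} (hk : k < L) :
    altSelect (Function.update χ n b) k (n - 1) = altSelect χ k (n - 1) := by
  refine altSelect_update χ n b k (n - 1) fun i hi h => ?_
  have h1 : ((i + 1 : ℕ) : ZMod L) = 0 := by
    push_cast
    linear_combination -h
  rw [ZMod.natCast_eq_zero_iff] at h1
  have := Nat.le_of_dvd i.succ_pos h1
  omega

theorem disorderAverage_altSelect [NeZero L] {p : ℝ} (hp1 : p ≤ 1) {k : ℕ} (hk : k ≤ L)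
    (n : ZMod L) :
    disorderAverage p (fun χ : ZMod L → Bool => if altSelect χ k n = true then 1 else 0) =
      (1 - p) / (2 - p) * (1 - (-(1 - p)) ^ k) := by
  induction k generalizing n with
  | zero => simp [altSelect, disorderAverage]
  | succ k ih =>
    have h : (fun χ : ZMod L → Bool => if altSelect χ (k + 1) n = true then (1 : ℝ) else 0) =
        fun χ => if χ n = true then 1 - (if altSelect χ k (n - 1) = true then 1 else 0) else 0 := by
      ext χ
      rw [altSelect]
      cases χ n <;> cases altSelect χ k (n - 1) <;> simp
    rw [h, disorderAverage_ite_tooth p n fun χ b => by rw [altSelect_update_pred χ n b hk],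
      disorderAverage_sub, disorderAverage_one, ih (by omega)]
    have : 2 - p ≠ 0 := by linarith
    field_simp
    ring

/-- Looking one site further changes the selection only if all sites looked at carry teeth. -/
theorem disorderAverage_altSelect_ne [NeZero L] (p : ℝ) {k : ℕ} (hk : k < L) (n : ZMod L) :
    disorderAverage p
        (fun χ : ZMod L → Bool => if altSelect χ (k + 1) n ≠ altSelect χ k n then 1 else 0) =
      (1 - p) ^ (k + 1) := by
  induction k generalizing n with
  | zero =>
    have h : (fun χ : ZMod L → Bool =>
        if altSelect χ (0 + 1) n ≠ altSelect χ 0 n then (1 : ℝ) else 0) =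
        fun χ => if χ n = true then 1 else 0 := by
      ext χ
      simp [altSelect]
    rw [h, disorderAverage_ite_tooth p n fun _ _ => rfl, disorderAverage_one]
    ring
  | succ k ih =>
    have h : (fun χ : ZMod L → Bool =>
        if altSelect χ (k + 1 + 1) n ≠ altSelect χ (k + 1) n then (1 : ℝ) else 0) =
        fun χ => if χ n = true then
          (if altSelect χ (k + 1) (n - 1) ≠ altSelect χ k (n - 1) then 1 else 0) else 0 := by
      ext χ
      rw [altSelect, show altSelect χ (k + 1) n = (χ n && !altSelect χ k (n - 1)) from rfl]
      cases χ n <;> cases altSelect χ (k + 1) (n - 1) <;> cases altSelect χ k (n - 1) <;> simp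
    rw [h, disorderAverage_ite_tooth p n fun χ b => by
      rw [altSelect_update_pred χ n b hk, altSelect_update_pred χ n b (by omega : k < L)],
      ih (by omega)]
    ring

/-- The sites selected by looking at `k + 1` or at `k` sites. Allowing both makes every tooth an end
of an edge `{n, n + 1}` with `n` selected, also where a run of teeth winds around the ring. -/
def selected [NeZero L] (χ : ZMod L → Bool) (k : ℕ) : Finset (ZMod L) :=
  {n | altSelect χ (k + 1) n = true ∨ altSelect χ k n = true}

theorem mem_selected_or_pred_mem [NeZero L] (χ : ZMod L → Bool) (k : ℕ) (n : ZMod L)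
    (h : χ n = true) : n ∈ selected χ k ∨ n - 1 ∈ selected χ k := by
  simp only [selected, Finset.mem_filter, Finset.mem_univ, true_and]
  cases h1 : altSelect χ k (n - 1)
  · exact Or.inl (Or.inl (by rw [altSelect, h, h1]; rfl))
  · exact Or.inr (Or.inr rfl)

theorem disorderAverage_card_selected_le [NeZero L] {p : ℝ} (hp0 : 0 ≤ p) (hp1 : p ≤ 1) {k : ℕ}
    (hk : k + 1 = L) :
    disorderAverage p (fun χ : ZMod L → Bool => ((selected χ k).card : ℝ)) ≤
      L * ((1 - p) / (2 - p) + 2 * (1 - p) ^ L) := by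
  have hcard : ∀ χ : ZMod L → Bool, ((selected χ k).card : ℝ) ≤
      ∑ n, ((if altSelect χ (k + 1) n = true then 1 else 0) +
        (if altSelect χ (k + 1) n ≠ altSelect χ k n then 1 else 0)) := fun χ => by
    rw [selected, Finset.card_filter]
    push_cast
    refine Finset.sum_le_sum fun n _ => ?_
    cases altSelect χ (k + 1) n <;> cases altSelect χ k n <;> simp
  refine (disorderAverage_mono hp0 hp1 hcard).trans ?_
  have hswap : ∀ f : ZMod L → (ZMod L → Bool) → ℝ,
      disorderAverage p (fun χ => ∑ n, f n χ) = ∑ n, disorderAverage p (f n) := fun f => by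
    simp only [disorderAverage, Finset.mul_sum]
    exact Finset.sum_comm
  rw [hswap, Finset.sum_congr rfl fun n _ => disorderAverage_add p _ _]
  simp only [disorderAverage_altSelect hp1 hk.le,
    disorderAverage_altSelect_ne p (show k < L by omega)]
  rw [Finset.sum_const, Finset.card_univ, ZMod.card, nsmul_eq_mul, hk]
  refine mul_le_mul_of_nonneg_left ?_ (Nat.cast_nonneg L)
  have hq : 0 ≤ 1 - p := by linarith
  have h1 : -(-(1 - p)) ^ L ≤ (1 - p) ^ L := by
    refine (neg_le_abs _).trans_eq ?_
    rw [abs_pow, abs_neg, abs_of_nonneg hq]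
  have h2 : (1 - p) / (2 - p) ≤ 1 := (div_le_one (by linarith)).mpr (by linarith)
  have h3 : 0 ≤ (1 - p) / (2 - p) := div_nonneg hq (by linarith)
  have h4 : (1 - p) / (2 - p) * -(-(1 - p)) ^ L ≤ (1 - p) ^ L :=
    (mul_le_mul_of_nonneg_left h1 h3).trans (mul_le_of_le_one_left (pow_nonneg hq L) h2)
  linarith

/-- On the full comb the spine edges `{2i, 2i + 1}` suffice. -/
theorem exists_card_le_of_full (L : ℕ) [NeZero L] :
    ∃ A : Finset (ZMod L), (∀ n, n ∈ A ∨ n - 1 ∈ A) ∧ A.card ≤ (L + 1) / 2 := by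
  classical
  refine ⟨(Finset.range ((L + 1) / 2)).image fun i => ((2 * i : ℕ) : ZMod L), fun n => ?_,
    Finset.card_image_le.trans_eq (Finset.card_range _)⟩
  have hlt := ZMod.val_lt n
  have hn : ((n.val : ℕ) : ZMod L) = n := ZMod.natCast_zmod_val n
  simp only [Finset.mem_image, Finset.mem_range]
  rcases Nat.even_or_odd' n.val with ⟨i, hi | hi⟩
  · exact Or.inl ⟨i, by omega, by rw [← hi, hn]⟩
  · refine Or.inr ⟨i, by omega, ?_⟩
    rw [hi] at hn
    rw [← hn]
    push_cast
    ring

end Disorder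

/-! ### Localization on the spine -/

theorem sum_Ploc_full_le (L : ℕ) [NeZero L] :
    ∑ n, Ploc (fun _ : ZMod L => true) n ≤ 17 / 18 * ((L + 1) / 2 : ℝ) := by
  obtain ⟨A, hA, hcard⟩ := exists_card_le_of_full L
  have h := sum_Ploc_le (χ := fun _ : ZMod L => true) (A := A) (fun n _ => hA n)
    (c := 17 * 1 / (1 + 17 * 1)) (by norm_num) fun E hE φ hφ h1 =>
      spineMass_le zero_le_one hE hφ h1 (by
        rw [one_mul, spineMass]
        exact (Fintype.sum_equiv (Equiv.subtypeUnivEquiv fun _ => rfl) _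
          (fun n => ‖φ (spine (fun _ : ZMod L => true) n)‖ ^ 2) fun _ => rfl).ge)
  have h2 : (A.card : ℝ) ≤ (L + 1) / 2 := by
    rw [le_div_iff₀ two_pos]
    exact_mod_cast (show A.card * 2 ≤ L + 1 by omega)
  linarith

theorem sum_Ploc_le_card_selected {L : ℕ} [NeZero L] (χ : ZMod L → Bool) (k : ℕ) :
    ∑ n, Ploc χ n ≤ 17 * L / (1 + 17 * L) * ((selected χ k).card : ℝ) :=
  sum_Ploc_le (mem_selected_or_pred_mem χ k) (by positivity) fun _ hE _ hφ h1 =>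
    spineMass_le (Nat.cast_nonneg L) hE hφ h1 (spineMass_le_mul_sum_tooth_root hE hφ)

end RandomComb

theorem mainTheorem4 (p : ℝ) (hp0 : 0 ≤ p) (hp1 : p ≤ 1) :
    ∃ L₀ : ℕ, ∀ (L : ℕ) [NeZero L], L₀ ≤ L → ∀ n₀ : ZMod L,
      RandomComb.disorderAverage p (fun χ : ZMod L → Bool => RandomComb.Ploc χ n₀)
        ≤ (1 - p) / (2 - p) := by
  rcases hp0.eq_or_lt with rfl | hp
  · -- `17 / 18 * (L + 1) / 2 ≤ L / 2` from `L = 17` on.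
    refine ⟨17, fun L _ hL n₀ => ?_⟩
    have hL' : (17 : ℝ) ≤ L := by exact_mod_cast hL
    have h := RandomComb.mul_disorderAverage_Ploc 0 n₀
    rw [RandomComb.disorderAverage_zero (fun χ : ZMod L → Bool => ∑ n, RandomComb.Ploc χ n)] at h
    have h2 := RandomComb.sum_Ploc_full_le L
    rw [← h] at h2
    have h3 : RandomComb.disorderAverage 0 (fun χ : ZMod L → Bool => RandomComb.Ploc χ n₀) ≤
        1 / 2 := by
      refine le_of_mul_le_mul_left (h2.trans ?_) (by linarith : (0 : ℝ) < L)
      linarith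
    norm_num at h3 ⊢
    exact h3
  · have hq : 0 ≤ 1 - p := by linarith
    -- The exponentially small excess `2 (1 - p) ^ L` is absorbed by the fraction `1 / (1 + 17 L)` of
    -- the mass that lies on the teeth.
    obtain ⟨L₀, hL₀⟩ : ∃ L₀ : ℕ, ∀ L ≥ L₀, L ≠ 0 → 68 * (L * (1 - p) ^ L) ≤ 1 - p := by
      rcases hq.eq_or_lt with h0 | h0
      · exact ⟨0, fun L _ hL => by simp [← h0, hL]⟩
      · have ht := tendsto_self_mul_const_pow_of_lt_one hq (by linarith : 1 - p < 1)
        obtain ⟨L₀, h⟩ := Filter.eventually_atTop.mp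
          (ht.eventually_lt_const (by positivity : 0 < (1 - p) / 68))
        exact ⟨L₀, fun L hL _ => by linarith [h L hL]⟩
    refine ⟨L₀, fun L _ hL n₀ => ?_⟩
    have hL0 : L ≠ 0 := NeZero.ne L
    have hLpos : (0 : ℝ) < L := by exact_mod_cast Nat.pos_of_ne_zero hL0
    obtain ⟨k, hk⟩ := Nat.exists_eq_succ_of_ne_zero hL0
    have h1 := RandomComb.disorderAverage_mono hp0 hp1 fun χ : ZMod L → Bool =>
      RandomComb.sum_Ploc_le_card_selected χ k
    rw [RandomComb.disorderAverage_const_mul, ← RandomComb.mul_disorderAverage_Ploc p n₀] at h1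
    have h2 := mul_le_mul_of_nonneg_left
      (RandomComb.disorderAverage_card_selected_le hp0 hp1 hk.symm)
      (by positivity : (0 : ℝ) ≤ 17 * L / (1 + 17 * L))
    refine le_of_mul_le_mul_left ((h1.trans h2).trans ?_) hLpos
    rw [mul_left_comm]
    refine mul_le_mul_of_nonneg_left ?_ hLpos.le
    rw [div_mul_eq_mul_div, div_le_iff₀ (by positivity)]
    have h3 : (1 - p) / 2 ≤ (1 - p) / (2 - p) :=
      div_le_div_of_nonneg_left hq (by linarith) (by linarith)
    have h4 := hL₀ L hL hL0
    linarith
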